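/- Let $\Bbbk$ be a field. Let $\mathcal{TL}_0(\Bbbk)$ be the strict $\Bbbk$-linear monoidal category with objects $[0],[1],[2],\dots$, tensor product $[m]\otimes[n]=[m+n]$ and unit $[0]$, whose morphisms are generated, under $\Bbbk$-linear combinations, composition and tensor product, by $\mathrm{cup}\colon[0]\to[2]$ and $\mathrm{cap}\colon[2]\to[0]$, subject to the relations $$(\mathrm{cap}\otimes\mathrm{id}_{[1]})\circ(\mathrm{id}_{[1]}\otimes\mathrm{cup})=0=(\mathrm{id}_{[1]}\otimes\mathrm{cap})\circ(\mathrm{cup}\otimes\mathrm{id}_{[1]}),\qquad \mathrm{cap}\circ\mathrm{cup}=\mathrm{id}_{[0]}.$$ A *Temperley–Lieb diagram* is a nonzero morphism of $\mathcal{TL}_0(\Bbbk)$ that can be obtained from $\mathrm{cup}$, $\mathrm{cap}$ and identity morphisms by composition and tensor product. A *cup diagram* (respectively *cap diagram*) is a nonzero morphism that can be obtained in this way from $\mathrm{cup}$ (respectively $\mathrm{cap}$) and identity morphisms only. Let $m,n\in\mathbb{N}$. Then: 1. The Temperley–Lieb diagrams $[m]\to[n]$ form a $\Bbbk$-basis of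 $\mathrm{Hom}_{\mathcal{TL}_0(\Bbbk)}([m],[n])$. 2. Hence $\mathrm{Hom}_{\mathcal{TL}_0(\Bbbk)}([m],[n])$ is finite-dimensional, of dimension the Catalan number $C_{(m+n)/2}$ if $m+n$ is even, and of dimension $0$ if $m+n$ is odd. 3. Every Temperley–Lieb diagram $x\colon[m]\to[n]$ can be written in exactly one way as $x=u\circ v$ with $v\colon[m]\to[l]$ a cap diagram and $u\colon[l]\to[n]$ a cup diagram (the object $[l]$, $u$ and $v$ are all unique). -/

import Mathlib

open CategoryTheory MonoidalCategory

universe u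

/-- Formal `R`-linear expressions for morphisms `m ⟶ n` of a strict monoidal category whose objects
are the natural numbers with tensor product `+`, built from `cup : 0 ⟶ 2` and `cap : 2 ⟶ 0`.
`comp f g` is written in diagrammatic order: first `f`, then `g`. -/
inductive TLTerm (R : Type u) : ℕ → ℕ → Type u
  | id (n : ℕ) : TLTerm R n n
  | cup : TLTerm R 0 2
  | cap : TLTerm R 2 0
  | comp {l m n : ℕ} (f : TLTerm R l m) (g : TLTerm R m n) : TLTerm R l n
  | tensor {m n m' n' : ℕ} (f : TLTerm R m n) (g : TLTerm R m' n') : TLTerm R (m + m') (n + n')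
  | zero (m n : ℕ) : TLTerm R m n
  | add {m n : ℕ} (f g : TLTerm R m n) : TLTerm R m n
  | smul {m n : ℕ} (r : R) (f : TLTerm R m n) : TLTerm R m n

namespace TLTerm

/-- Transport of an expression along equalities of its source and target. -/
def cast {R : Type u} {m m' n n' : ℕ} (hm : m = m') (hn : n = n') (f : TLTerm R m n) :
    TLTerm R m' n' :=
  hn ▸ hm ▸ f

/-- The smallest congruence on expressions that makes them the morphisms of a strict `R`-linear
monoidal category in which the two zig-zags equal `q • id` and the circle equals `(q ^ 2 + 1) • id`.
-/
inductive Rel {R : Type u} [CommRing R] (q : R) :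
    ∀ {m n : ℕ}, TLTerm R m n → TLTerm R m n → Prop
  -- equivalence relation
  | refl {m n : ℕ} (f : TLTerm R m n) : Rel q f f
  | symm {m n : ℕ} {f g : TLTerm R m n} : Rel q f g → Rel q g f
  | trans {m n : ℕ} {f g h : TLTerm R m n} : Rel q f g → Rel q g h → Rel q f h
  -- compatibility with the operations
  | comp_congr {l m n : ℕ} {f f' : TLTerm R l m} {g g' : TLTerm R m n} :
      Rel q f f' → Rel q g g' → Rel q (comp f g) (comp f' g')
  | tensor_congr {m n m' n' : ℕ} {f f' : TLTerm R m n} {g g' : TLTerm R m' n'} :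
      Rel q f f' → Rel q g g' → Rel q (tensor f g) (tensor f' g')
  | add_congr {m n : ℕ} {f f' g g' : TLTerm R m n} :
      Rel q f f' → Rel q g g' → Rel q (add f g) (add f' g')
  | smul_congr {m n : ℕ} (r : R) {f f' : TLTerm R m n} :
      Rel q f f' → Rel q (smul r f) (smul r f')
  -- category axioms
  | id_comp {m n : ℕ} (f : TLTerm R m n) : Rel q (comp (id m) f) f
  | comp_id {m n : ℕ} (f : TLTerm R m n) : Rel q (comp f (id n)) f
  | assoc {k l m n : ℕ} (f : TLTerm R k l) (g : TLTerm R l m) (h : TLTerm R m n) :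
      Rel q (comp (comp f g) h) (comp f (comp g h))
  -- the morphisms `m ⟶ n` form an `R`-module
  | add_assoc {m n : ℕ} (f g h : TLTerm R m n) : Rel q (add (add f g) h) (add f (add g h))
  | add_comm {m n : ℕ} (f g : TLTerm R m n) : Rel q (add f g) (add g f)
  | zero_add {m n : ℕ} (f : TLTerm R m n) : Rel q (add (zero m n) f) f
  | smul_add {m n : ℕ} (r : R) (f g : TLTerm R m n) :
      Rel q (smul r (add f g)) (add (smul r f) (smul r g))
  | add_smul {m n : ℕ} (r s : R) (f : TLTerm R m n) :
      Rel q (smul (r + s) f) (add (smul r f) (smul s f))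
  | mul_smul {m n : ℕ} (r s : R) (f : TLTerm R m n) : Rel q (smul (r * s) f) (smul r (smul s f))
  | one_smul {m n : ℕ} (f : TLTerm R m n) : Rel q (smul 1 f) f
  | zero_smul {m n : ℕ} (f : TLTerm R m n) : Rel q (smul 0 f) (zero m n)
  -- composition is bilinear
  | add_comp {l m n : ℕ} (f f' : TLTerm R l m) (g : TLTerm R m n) :
      Rel q (comp (add f f') g) (add (comp f g) (comp f' g))
  | comp_add {l m n : ℕ} (f : TLTerm R l m) (g g' : TLTerm R m n) :
      Rel q (comp f (add g g')) (add (comp f g) (comp f g'))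
  | smul_comp {l m n : ℕ} (r : R) (f : TLTerm R l m) (g : TLTerm R m n) :
      Rel q (comp (smul r f) g) (smul r (comp f g))
  | comp_smul {l m n : ℕ} (r : R) (f : TLTerm R l m) (g : TLTerm R m n) :
      Rel q (comp f (smul r g)) (smul r (comp f g))
  -- the tensor product is bilinear
  | add_tensor {m n m' n' : ℕ} (f f' : TLTerm R m n) (g : TLTerm R m' n') :
      Rel q (tensor (add f f') g) (add (tensor f g) (tensor f' g))
  | tensor_add {m n m' n' : ℕ} (f : TLTerm R m n) (g g' : TLTerm R m' n') :
      Rel q (tensor f (add g g')) (add (tensor f g) (tensor f g'))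
  | smul_tensor {m n m' n' : ℕ} (r : R) (f : TLTerm R m n) (g : TLTerm R m' n') :
      Rel q (tensor (smul r f) g) (smul r (tensor f g))
  | tensor_smul {m n m' n' : ℕ} (r : R) (f : TLTerm R m n) (g : TLTerm R m' n') :
      Rel q (tensor f (smul r g)) (smul r (tensor f g))
  -- the tensor product is a functor, strictly associative and strictly unital
  | id_tensor_id (m n : ℕ) : Rel q (tensor (id m) (id n)) (id (m + n))
  | interchange {l m n l' m' n' : ℕ} (f : TLTerm R l m) (g : TLTerm R m n)
      (f' : TLTerm R l' m') (g' : TLTerm R m' n') :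
      Rel q (tensor (comp f g) (comp f' g')) (comp (tensor f f') (tensor g g'))
  | tensor_assoc {m n m' n' m'' n'' : ℕ} (f : TLTerm R m n) (g : TLTerm R m' n')
      (h : TLTerm R m'' n'') :
      Rel q (cast (Nat.add_assoc m m' m'') (Nat.add_assoc n n' n'') (tensor (tensor f g) h))
        (tensor f (tensor g h))
  | unit_tensor {m n : ℕ} (f : TLTerm R m n) :
      Rel q (cast (Nat.zero_add m) (Nat.zero_add n) (tensor (id 0) f)) f
  | tensor_unit {m n : ℕ} (f : TLTerm R m n) :
      Rel q (cast (Nat.add_zero m) (Nat.add_zero n) (tensor f (id 0))) f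
  -- the relations on cups and caps
  | zigzag_left : Rel q (m := 1) (n := 1)
      (comp (tensor (id 1) cup) (tensor cap (id 1))) (smul q (id 1))
  | zigzag_right : Rel q (m := 1) (n := 1)
      (comp (tensor cup (id 1)) (tensor (id 1) cap)) (smul q (id 1))
  | circle : Rel q (comp cup cap) (smul (q ^ 2 + 1) (id 0))

/-- Expressions `m ⟶ n` up to the congruence `Rel q`. -/
def setoid {R : Type u} [CommRing R] (q : R) (m n : ℕ) : Setoid (TLTerm R m n) where
  r := Rel q
  iseqv := ⟨Rel.refl, Rel.symm, Rel.trans⟩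

end TLTerm

/-- The objects of the renormalized Temperley--Lieb category with parameter `q : R`: the object
`⟨n⟩` is the natural number `n`. -/
@[ext]
structure TLBar (R : Type u) [CommRing R] (q : R) : Type where
  n : ℕ

namespace TLBar

section

variable {R : Type u} [CommRing R] {q : R}

/-- Morphisms of the renormalized Temperley--Lieb category: the quotient of formal expressions by
the congruence `TLTerm.Rel q`. -/
def Hom (X Y : TLBar R q) : Type u := Quotient (TLTerm.setoid q X.n Y.n)

instance : Category (TLBar R q) where
  Hom := Hom
  id X := Quotient.mk _ (TLTerm.id X.n)
  comp := Quotient.map₂ TLTerm.comp fun _ _ h _ _ h' => TLTerm.Rel.comp_congr h h'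
  id_comp := by rintro X Y ⟨f⟩; exact Quotient.sound (TLTerm.Rel.id_comp f)
  comp_id := by rintro X Y ⟨f⟩; exact Quotient.sound (TLTerm.Rel.comp_id f)
  assoc := by rintro X Y Z W ⟨f⟩ ⟨g⟩ ⟨h⟩; exact Quotient.sound (TLTerm.Rel.assoc f g h)

/-- The morphism represented by an expression. -/
def mkHom (q : R) {m n : ℕ} (f : TLTerm R m n) : (⟨m⟩ : TLBar R q) ⟶ ⟨n⟩ :=
  Quotient.mk (TLTerm.setoid q m n) f

/-- The generating morphism `cup : 0 ⟶ 2`. -/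
def cup (q : R) : (⟨0⟩ : TLBar R q) ⟶ ⟨2⟩ := mkHom q TLTerm.cup

/-- The generating morphism `cap : 2 ⟶ 0`. -/
def cap (q : R) : (⟨2⟩ : TLBar R q) ⟶ ⟨0⟩ := mkHom q TLTerm.cap

instance (X Y : TLBar R q) : Zero (X ⟶ Y) := ⟨mkHom q (TLTerm.zero X.n Y.n)⟩

instance (X Y : TLBar R q) : Add (X ⟶ Y) :=
  ⟨Quotient.map₂ TLTerm.add fun _ _ h _ _ h' => TLTerm.Rel.add_congr h h'⟩

instance (X Y : TLBar R q) : SMul R (X ⟶ Y) :=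
  ⟨fun r => Quotient.map (TLTerm.smul r) fun _ _ h => TLTerm.Rel.smul_congr r h⟩

instance (X Y : TLBar R q) : Neg (X ⟶ Y) := ⟨fun f => (-1 : R) • f⟩

theorem hom_zero_add {X Y : TLBar R q} (f : X ⟶ Y) : 0 + f = f := by
  rcases f with ⟨f⟩; exact Quotient.sound (TLTerm.Rel.zero_add f)

theorem hom_add_comm {X Y : TLBar R q} (f g : X ⟶ Y) : f + g = g + f := by
  rcases f with ⟨f⟩; rcases g with ⟨g⟩; exact Quotient.sound (TLTerm.Rel.add_comm f g)

theorem hom_add_assoc {X Y : TLBar R q} (f g h : X ⟶ Y) : f + g + h = f + (g + h) := by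
  rcases f with ⟨f⟩; rcases g with ⟨g⟩; rcases h with ⟨h⟩
  exact Quotient.sound (TLTerm.Rel.add_assoc f g h)

theorem hom_one_smul {X Y : TLBar R q} (f : X ⟶ Y) : (1 : R) • f = f := by
  rcases f with ⟨f⟩; exact Quotient.sound (TLTerm.Rel.one_smul f)

theorem hom_zero_smul {X Y : TLBar R q} (f : X ⟶ Y) : (0 : R) • f = 0 := by
  rcases f with ⟨f⟩; exact Quotient.sound (TLTerm.Rel.zero_smul f)

theorem hom_add_smul {X Y : TLBar R q} (r s : R) (f : X ⟶ Y) : (r + s) • f = r • f + s • f := by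
  rcases f with ⟨f⟩; exact Quotient.sound (TLTerm.Rel.add_smul r s f)

theorem hom_mul_smul {X Y : TLBar R q} (r s : R) (f : X ⟶ Y) : (r * s) • f = r • s • f := by
  rcases f with ⟨f⟩; exact Quotient.sound (TLTerm.Rel.mul_smul r s f)

theorem hom_smul_add {X Y : TLBar R q} (r : R) (f g : X ⟶ Y) : r • (f + g) = r • f + r • g := by
  rcases f with ⟨f⟩; rcases g with ⟨g⟩; exact Quotient.sound (TLTerm.Rel.smul_add r f g)

theorem hom_smul_zero {X Y : TLBar R q} (r : R) : r • (0 : X ⟶ Y) = 0 := by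
  rw [← hom_zero_smul (0 : X ⟶ Y), ← hom_mul_smul, mul_zero]

instance (X Y : TLBar R q) : AddCommGroup (X ⟶ Y) where
  add_assoc := hom_add_assoc
  zero_add := hom_zero_add
  add_zero f := by rw [hom_add_comm, hom_zero_add]
  add_comm := hom_add_comm
  nsmul := nsmulRec
  zsmul := zsmulRec
  neg_add_cancel f := by
    change (-1 : R) • f + f = 0
    conv_lhs => rw [← hom_one_smul f]
    rw [← hom_mul_smul, mul_one, ← hom_add_smul, neg_add_cancel, hom_zero_smul]

instance (X Y : TLBar R q) : Module R (X ⟶ Y) where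
  one_smul := hom_one_smul
  mul_smul := hom_mul_smul
  smul_zero := hom_smul_zero
  smul_add := hom_smul_add
  add_smul := hom_add_smul
  zero_smul := hom_zero_smul

instance : Preadditive (TLBar R q) where
  add_comp := by rintro X Y Z ⟨f⟩ ⟨f'⟩ ⟨g⟩; exact Quotient.sound (TLTerm.Rel.add_comp f f' g)
  comp_add := by rintro X Y Z ⟨f⟩ ⟨g⟩ ⟨g'⟩; exact Quotient.sound (TLTerm.Rel.comp_add f g g')

instance : Linear R (TLBar R q) where
  smul_comp := by rintro X Y Z r ⟨f⟩ ⟨g⟩; exact Quotient.sound (TLTerm.Rel.smul_comp r f g)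
  comp_smul := by rintro X Y Z ⟨f⟩ r ⟨g⟩; exact Quotient.sound (TLTerm.Rel.comp_smul r f g)

/-- The tensor product of morphisms. -/
def tensorHom {X₁ Y₁ X₂ Y₂ : TLBar R q} (f : X₁ ⟶ Y₁) (g : X₂ ⟶ Y₂) :
    (⟨X₁.n + X₂.n⟩ : TLBar R q) ⟶ ⟨Y₁.n + Y₂.n⟩ :=
  Quotient.map₂ TLTerm.tensor (fun _ _ h _ _ h' => TLTerm.Rel.tensor_congr h h') f g

theorem mkHom_cast {m m' n n' : ℕ} (hm : m = m') (hn : n = n') (f : TLTerm R m n) :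
    mkHom q (TLTerm.cast hm hn f) =
      eqToHom (by rw [hm]) ≫ mkHom q f ≫ eqToHom (by rw [hn]) := by
  subst hm; subst hn; simp [TLTerm.cast]

theorem tensorHom_id (X Y : TLBar R q) :
    tensorHom (𝟙 X) (𝟙 Y) = 𝟙 (⟨X.n + Y.n⟩ : TLBar R q) :=
  Quotient.sound (TLTerm.Rel.id_tensor_id X.n Y.n)

theorem tensorHom_eqToHom {X X' Y Y' : TLBar R q} (h : X = X') (h' : Y = Y') :
    tensorHom (eqToHom h) (eqToHom h') = eqToHom (by rw [h, h']) := by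
  subst h; subst h'; simp [tensorHom_id]

theorem tensorHom_comp {X₁ Y₁ Z₁ X₂ Y₂ Z₂ : TLBar R q} (f₁ : X₁ ⟶ Y₁) (f₂ : X₂ ⟶ Y₂)
    (g₁ : Y₁ ⟶ Z₁) (g₂ : Y₂ ⟶ Z₂) :
    tensorHom (f₁ ≫ g₁) (f₂ ≫ g₂) = tensorHom f₁ f₂ ≫ tensorHom g₁ g₂ := by
  rcases f₁ with ⟨f₁⟩; rcases f₂ with ⟨f₂⟩; rcases g₁ with ⟨g₁⟩; rcases g₂ with ⟨g₂⟩
  exact Quotient.sound (TLTerm.Rel.interchange f₁ g₁ f₂ g₂)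

theorem obj_assoc (X Y Z : TLBar R q) :
    (⟨X.n + Y.n + Z.n⟩ : TLBar R q) = ⟨X.n + (Y.n + Z.n)⟩ := by rw [Nat.add_assoc]

theorem obj_zero_add (X : TLBar R q) : (⟨0 + X.n⟩ : TLBar R q) = X := by
  ext; exact Nat.zero_add _

theorem tensorHom_assoc {X₁ Y₁ X₂ Y₂ X₃ Y₃ : TLBar R q} (f : X₁ ⟶ Y₁) (g : X₂ ⟶ Y₂)
    (h : X₃ ⟶ Y₃) :
    tensorHom (tensorHom f g) h ≫ eqToHom (obj_assoc Y₁ Y₂ Y₃) =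
      eqToHom (obj_assoc X₁ X₂ X₃) ≫ tensorHom f (tensorHom g h) := by
  rcases f with ⟨f⟩; rcases g with ⟨g⟩; rcases h with ⟨h⟩
  have e : mkHom q _ = mkHom q _ := Quotient.sound (TLTerm.Rel.tensor_assoc (q := q) f g h)
  rw [mkHom_cast] at e
  change mkHom q (TLTerm.tensor (TLTerm.tensor f g) h) ≫ _ =
    _ ≫ mkHom q (TLTerm.tensor f (TLTerm.tensor g h))
  rw [← e]; simp

theorem unit_tensorHom {X Y : TLBar R q} (f : X ⟶ Y) :
    tensorHom (𝟙 (⟨0⟩ : TLBar R q)) f ≫ eqToHom (obj_zero_add Y) =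
      eqToHom (obj_zero_add X) ≫ f := by
  rcases f with ⟨f⟩
  have e : mkHom q _ = mkHom q _ := Quotient.sound (TLTerm.Rel.unit_tensor (q := q) f)
  rw [mkHom_cast] at e
  change mkHom q (TLTerm.tensor (TLTerm.id 0) f) ≫ _ = _ ≫ mkHom q f
  rw [← e]; simp

theorem tensorHom_unit {X Y : TLBar R q} (f : X ⟶ Y) :
    tensorHom f (𝟙 (⟨0⟩ : TLBar R q)) = f := by
  rcases f with ⟨f⟩
  exact Quotient.sound (TLTerm.Rel.tensor_unit (q := q) f)

/-- The strict monoidal structure: `m ⊗ n = m + n` on objects, and all coherence isomorphisms are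
identities, transported along the equalities of natural numbers. -/
instance : MonoidalCategory (TLBar R q) where
  tensorObj X Y := ⟨X.n + Y.n⟩
  tensorUnit := ⟨0⟩
  tensorHom := tensorHom
  whiskerLeft X _ _ f := tensorHom (𝟙 X) f
  whiskerRight f Y := tensorHom f (𝟙 Y)
  associator X Y Z := eqToIso (obj_assoc X Y Z)
  leftUnitor X := eqToIso (obj_zero_add X)
  rightUnitor X := eqToIso rfl
  tensorHom_def f g := by rw [← tensorHom_comp, Category.comp_id, Category.id_comp]
  id_tensorHom_id := tensorHom_id
  tensorHom_comp_tensorHom f₁ f₂ g₁ g₂ := (tensorHom_comp f₁ f₂ g₁ g₂).symm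
  whiskerLeft_id := tensorHom_id
  id_whiskerRight := tensorHom_id
  associator_naturality := tensorHom_assoc
  leftUnitor_naturality := unit_tensorHom
  rightUnitor_naturality {X Y} f := by
    change tensorHom f (𝟙 (⟨0⟩ : TLBar R q)) ≫ 𝟙 Y = 𝟙 X ≫ f
    rw [tensorHom_unit]
    exact (Category.comp_id (Y := Y) f).trans (Category.id_comp f).symm
  pentagon W X Y Z := by
    simp only [eqToIso.hom, ← eqToHom_refl _ rfl, tensorHom_eqToHom, eqToHom_trans]
  triangle X Y := by
    simp only [eqToIso.hom, ← eqToHom_refl _ rfl, tensorHom_eqToHom, eqToHom_trans]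

instance : MonoidalPreadditive (TLBar R q) := by
  have add_left : ∀ {W X Y Z : TLBar R q} (f f' : W ⟶ X) (g : Y ⟶ Z),
      tensorHom (f + f') g = tensorHom f g + tensorHom f' g := by
    rintro W X Y Z ⟨f⟩ ⟨f'⟩ ⟨g⟩; exact Quotient.sound (TLTerm.Rel.add_tensor f f' g)
  have add_right : ∀ {W X Y Z : TLBar R q} (f : W ⟶ X) (g g' : Y ⟶ Z),
      tensorHom f (g + g') = tensorHom f g + tensorHom f g' := by
    rintro W X Y Z ⟨f⟩ ⟨g⟩ ⟨g'⟩; exact Quotient.sound (TLTerm.Rel.tensor_add f g g')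
  exact
    { whiskerLeft_zero := fun {X Y Z} => by
        have h := add_right (𝟙 X) (0 : Y ⟶ Z) 0
        rw [add_zero] at h
        exact left_eq_add.mp h
      zero_whiskerRight := fun {X Y Z} => by
        have h := add_left (0 : Y ⟶ Z) 0 (𝟙 X)
        rw [add_zero] at h
        exact left_eq_add.mp h
      whiskerLeft_add := fun f g => add_right _ f g
      add_whiskerRight := fun f g => add_left f g _ }

instance : MonoidalLinear R (TLBar R q) where
  whiskerLeft_smul := by
    rintro X Y Z r ⟨f⟩; exact Quotient.sound (TLTerm.Rel.tensor_smul r (TLTerm.id X.n) f)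
  smul_whiskerRight := by
    rintro r X Y ⟨f⟩ Z; exact Quotient.sound (TLTerm.Rel.smul_tensor r f (TLTerm.id Z.n))

end

end TLBar

/-- The crystal Temperley--Lieb category: both zig-zags are `0 • id` and the circle is
`(0 ^ 2 + 1) • id`. -/
abbrev TL0 (k : Type u) [CommRing k] : Type := TLBar k (0 : k)

namespace TL0

/-- The morphisms of `TL0 k` obtained from identity morphisms, `cup` (if `useCup` holds) and `cap`
(if `useCap` holds) by composition and tensor product. -/
inductive Generated (k : Type u) [CommRing k] (useCup useCap : Prop) :
    ∀ {X Y : TL0 k}, (X ⟶ Y) → Prop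
  | id (X : TL0 k) : Generated k useCup useCap (𝟙 X)
  | cup : useCup → Generated k useCup useCap (TLBar.cup (0 : k))
  | cap : useCap → Generated k useCup useCap (TLBar.cap (0 : k))
  | comp {X Y Z : TL0 k} {f : X ⟶ Y} {g : Y ⟶ Z} : Generated k useCup useCap f →
      Generated k useCup useCap g → Generated k useCup useCap (f ≫ g)
  | tensor {X Y X' Y' : TL0 k} {f : X ⟶ Y} {g : X' ⟶ Y'} : Generated k useCup useCap f →
      Generated k useCup useCap g → Generated k useCup useCap (f ⊗ₘ g)

/-- Temperley--Lieb diagrams: nonzero morphisms obtained from `cup`, `cap` and identities. -/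
def IsDiagram {k : Type u} [CommRing k] {X Y : TL0 k} (f : X ⟶ Y) : Prop :=
  f ≠ 0 ∧ Generated k True True f

/-- Cup diagrams: nonzero morphisms obtained from `cup` and identities. -/
def IsCupDiagram {k : Type u} [CommRing k] {X Y : TL0 k} (f : X ⟶ Y) : Prop :=
  f ≠ 0 ∧ Generated k True False f

/-- Cap diagrams: nonzero morphisms obtained from `cap` and identities. -/
def IsCapDiagram {k : Type u} [CommRing k] {X Y : TL0 k} (f : X ⟶ Y) : Prop :=
  f ≠ 0 ∧ Generated k False True f

end TL0

/-! A diagram is determined by two ballot words with equally many unmatched letters: one places caps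
on the source, the other places cups on the target, and the unmatched letters are joined by through
strands. The composite is `diagram`, and the theorem says that these composites are the nonzero
products of generators and form a basis.

Spanning: any product of generators is a composite of layers, each a single cup or cap between
vertical strands. When a cap layer follows a cup diagram, the cap closes a cup to a circle (value
1), or shares exactly one leg with a cup (a zig-zag, value 0), or slides past the cups. So every
product is zero or has all its caps before its cups (`cupDiagram_comp_capLayer`,
`Generated.eq_zero_or_exists_eq_diagram`).

Independence: the category acts on tensor powers of a free module of rank 2, with cup sent to `e
true ⊗ e false` and cap to the dual functional; the relations hold because a zig-zag would force its
middle letter to be both `true` and `false` (`Rel.entry_eq`). Reading off the entry of a diagram at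
the two words of another gives a unitriangular system with respect to the number of through strands
(`entry_diagram_word_self`, `entry_diagram_word`).

Bending the source points round to the target identifies pairs of words with balanced words of
length m + n, which gives the Catalan number. Unique factorization follows because distinct pairs of
words give distinct diagrams. -/

/-! ### Ballot words and their number -/

/-- Words of length `n` in opening and closing parentheses in which every closing parenthesis is
matched and exactly `l` opening parentheses are unmatched. -/
inductive Ballot : ℕ → ℕ → Type
  | nil : Ballot 0 0
  | up {n l : ℕ} (a : Ballot n l) : Ballot (n + 1) (l + 1)
  | down {n l : ℕ} (a : Ballot n (l + 1)) : Ballot (n + 1) l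

namespace Ballot

def succZeroEquiv (n : ℕ) : Ballot (n + 1) 0 ≃ Ballot n 1 where
  toFun | down a => a
  invFun := down
  left_inv | down _ => rfl
  right_inv _ := rfl

def succSuccEquiv (n l : ℕ) : Ballot (n + 1) (l + 1) ≃ Ballot n l ⊕ Ballot n (l + 2) where
  toFun | up a => .inl a | down a => .inr a
  invFun := Sum.elim up down
  left_inv | up _ => rfl | down _ => rfl
  right_inv | .inl _ => rfl | .inr _ => rfl

instance : Unique (Ballot 0 0) where
  default := nil
  uniq | nil => rfl

instance (l : ℕ) : IsEmpty (Ballot 0 (l + 1)) := ⟨nofun⟩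

instance finite : ∀ n l, Finite (Ballot n l)
  | 0, 0 => inferInstance
  | 0, _ + 1 => inferInstance
  | n + 1, 0 => have := finite n 1; .of_equiv _ (succZeroEquiv n).symm
  | n + 1, l + 1 =>
    have := finite n l
    have := finite n (l + 2)
    .of_equiv _ (succSuccEquiv n l).symm

theorem card_succ_zero (n : ℕ) : Nat.card (Ballot (n + 1) 0) = Nat.card (Ballot n 1) :=
  Nat.card_congr (succZeroEquiv n)

theorem card_succ_succ (n l : ℕ) :
    Nat.card (Ballot (n + 1) (l + 1)) = Nat.card (Ballot n l) + Nat.card (Ballot n (l + 2)) := by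
  rw [Nat.card_congr (succSuccEquiv n l), Nat.card_sum]

theorem le {n l : ℕ} (a : Ballot n l) : l ≤ n := by
  induction a <;> omega

theorem even_add {n l : ℕ} (a : Ballot n l) : Even (n + l) := by
  induction a with
  | nil => simp
  | up a ih => obtain ⟨c, hc⟩ := ih; exact ⟨c + 1, by omega⟩
  | down a ih => obtain ⟨c, hc⟩ := ih; exact ⟨c, by omega⟩

theorem card_self (n : ℕ) : Nat.card (Ballot n n) = 1 := by
  induction n with
  | zero => simp
  | succ n ih =>
    have : IsEmpty (Ballot n (n + 2)) := ⟨fun a => by have := a.le; omega⟩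
    rw [card_succ_succ, ih, Nat.card_of_isEmpty]

/-- The ballot numbers are differences of neighbouring binomial coefficients. -/
theorem card_add_choose (n l p : ℕ) (h : n = l + 2 * (p + 1)) :
    Nat.card (Ballot n l) + n.choose p = n.choose (p + 1) := by
  induction n generalizing l p with
  | zero => omega
  | succ n ih =>
    cases l with
    | zero =>
      rw [card_succ_zero]
      cases p with
      | zero =>
        obtain rfl : n = 1 := by omega
        rw [card_self]; rfl
      | succ p =>
        have := ih 1 p (by omega)
        -- At l = 0 the recursion has only one summand. The missing one would be the difference of
        -- the two middle binomial coefficients of n = 2p + 3, which vanishes by symmetry.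
        have hs : n.choose (p + 1 + 1) = n.choose (p + 1) := by
          apply Nat.choose_symm_of_eq_add; omega
        rw [Nat.choose_succ_succ, Nat.choose_succ_succ n (p + 1)]
        simp only [Nat.succ_eq_add_one]
        omega
    | succ l =>
      rw [card_succ_succ]
      cases p with
      | zero =>
        obtain rfl : n = l + 2 := by omega
        have := ih l 0 (by omega)
        rw [card_self]
        simp at this ⊢
        omega
      | succ p =>
        have h1 := ih l (p + 1) (by omega)
        have h2 := ih (l + 2) p (by omega)
        rw [Nat.choose_succ_succ, Nat.choose_succ_succ n (p + 1)]
        simp only [Nat.succ_eq_add_one]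
        omega

theorem card_eq_catalan (p : ℕ) : Nat.card (Ballot (2 * p) 0) = catalan p := by
  cases p with
  | zero => simp
  | succ p =>
    have h := card_add_choose (2 * (p + 1)) 0 p (by omega)
    have h1 := succ_mul_catalan_eq_centralBinom (p + 1)
    rw [Nat.centralBinom_eq_two_mul_choose] at h1
    have h2 := Nat.choose_succ_right_eq (2 * (p + 1)) p
    rw [show 2 * (p + 1) - p = p + 2 by omega] at h2
    -- Both sides are the central binomial coefficient: the factor p + 2 turns the subtracted
    -- neighbour into p + 1 times the central one.
    have : (p + 2) * Nat.card (Ballot (2 * (p + 1)) 0) = (p + 2) * catalan (p + 1) := by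
      rw [show (p + 2) = p + 1 + 1 from rfl, h1]
      zify at h h2 ⊢
      linear_combination (p + 2 : ℤ) * h + h2
    exact Nat.eq_of_mul_eq_mul_left (by omega) this

end Ballot

/-! ### Pairs of ballot words and the Catalan count -/

/-- Pairs of a ballot word of length `m` and one of length `n` with as many unmatched letters. -/
abbrev BallotPair (m n : ℕ) : Type := Σ l, Ballot m l × Ballot n l

namespace BallotPair

/-- This bends the rightmost source point round to the right end of the target. A through strand
ending there becomes a cup, and a cap ending there becomes a through strand. -/
def shiftEquiv (m n : ℕ) : BallotPair (m + 1) n ≃ BallotPair m (n + 1) where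
  toFun
    | ⟨_, .up b, a⟩ => ⟨_, b, .down a⟩
    | ⟨_, .down b, a⟩ => ⟨_, b, .up a⟩
  invFun
    | ⟨_, b, .down a⟩ => ⟨_, .up b, a⟩
    | ⟨_, b, .up a⟩ => ⟨_, .down b, a⟩
  left_inv
    | ⟨_, .up _, _⟩ => rfl
    | ⟨_, .down _, _⟩ => rfl
  right_inv
    | ⟨_, _, .down _⟩ => rfl
    | ⟨_, _, .up _⟩ => rfl

def zeroEquiv (n : ℕ) : BallotPair 0 n ≃ Ballot n 0 where
  toFun | ⟨_, .nil, a⟩ => a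
  invFun a := ⟨0, .nil, a⟩
  left_inv | ⟨_, .nil, _⟩ => rfl
  right_inv _ := rfl

def equivBallot : ∀ m n, BallotPair m n ≃ Ballot (m + n) 0
  | 0, n => (zeroEquiv n).trans (Equiv.cast (by rw [Nat.zero_add]))
  | m + 1, n => ((shiftEquiv m n).trans (equivBallot m (n + 1))).trans
      (Equiv.cast (by congr 1; omega))

instance (m n : ℕ) : Finite (BallotPair m n) := .of_equiv _ (equivBallot m n).symm

theorem card_of_even {m n : ℕ} (h : Even (m + n)) :
    Nat.card (BallotPair m n) = catalan ((m + n) / 2) := by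
  obtain ⟨p, hp⟩ := h
  rw [Nat.card_congr (equivBallot m n), hp, ← two_mul, Ballot.card_eq_catalan,
    Nat.mul_div_cancel_left p two_pos]

theorem card_of_odd {m n : ℕ} (h : Odd (m + n)) : Nat.card (BallotPair m n) = 0 := by
  have : IsEmpty (Ballot (m + n) 0) := ⟨fun a => Nat.not_even_iff_odd.2 h a.even_add⟩
  rw [Nat.card_congr (equivBallot m n), Nat.card_of_isEmpty]

end BallotPair

/-! ### Reflection and the calculus of strands, cups and caps -/

namespace TLTerm

/-- The reflection of an expression in a horizontal line. -/
def flip {R : Type u} {m n : ℕ} : TLTerm R m n → TLTerm R n m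
  | id n => id n
  | cup => cap
  | cap => cup
  | comp f g => comp g.flip f.flip
  | tensor f g => tensor f.flip g.flip
  | zero m n => zero n m
  | add f g => add f.flip g.flip
  | smul r f => smul r f.flip

theorem flip_cast {R : Type u} {m m' n n' : ℕ} (hm : m = m') (hn : n = n') (f : TLTerm R m n) :
    (cast hm hn f).flip = cast hn hm f.flip := by
  subst hm; subst hn; rfl

theorem flip_flip {R : Type u} {m n : ℕ} (f : TLTerm R m n) : f.flip.flip = f := by
  induction f <;> simp_all [flip]

/-- The defining relations are symmetric under reflection: the two zig-zags are interchanged and the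
circle is fixed. Statements about caps thereby follow from those about cups. -/
theorem Rel.flip {R : Type u} [CommRing R] {q : R} {m n : ℕ} {f g : TLTerm R m n} (h : Rel q f g) :
    Rel q f.flip g.flip := by
  induction h with
  | refl => exact .refl _
  | symm _ ih => exact ih.symm
  | trans _ _ ih ih' => exact ih.trans ih'
  | comp_congr _ _ ih ih' => exact ih'.comp_congr ih
  | tensor_congr _ _ ih ih' => exact ih.tensor_congr ih'
  | add_congr _ _ ih ih' => exact ih.add_congr ih'
  | smul_congr r _ ih => exact ih.smul_congr r
  | id_comp => exact .comp_id _
  | comp_id => exact .id_comp _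
  | assoc => exact (Rel.assoc _ _ _).symm
  | add_assoc => exact .add_assoc _ _ _
  | add_comm => exact .add_comm _ _
  | zero_add => exact .zero_add _
  | smul_add => exact .smul_add _ _ _
  | add_smul => exact .add_smul _ _ _
  | mul_smul => exact .mul_smul _ _ _
  | one_smul => exact .one_smul _
  | zero_smul => exact .zero_smul _
  | add_comp => exact .comp_add _ _ _
  | comp_add => exact .add_comp _ _ _
  | smul_comp => exact .comp_smul _ _ _
  | comp_smul => exact .smul_comp _ _ _
  | add_tensor => exact .add_tensor _ _ _
  | tensor_add => exact .tensor_add _ _ _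
  | smul_tensor => exact .smul_tensor _ _ _
  | tensor_smul => exact .tensor_smul _ _ _
  | id_tensor_id => exact .id_tensor_id _ _
  | interchange => exact .interchange _ _ _ _
  | tensor_assoc => rw [flip_cast]; exact .tensor_assoc _ _ _
  | unit_tensor => rw [flip_cast]; exact .unit_tensor _
  | tensor_unit => rw [flip_cast]; exact .tensor_unit _
  | zigzag_left => exact .zigzag_right
  | zigzag_right => exact .zigzag_left
  | circle => exact .circle

end TLTerm

namespace TLBar

variable {R : Type u} [CommRing R] {q : R}

/-- The reflection of a morphism in a horizontal line. -/
def flip {X Y : TLBar R q} (f : X ⟶ Y) : Y ⟶ X :=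
  Quotient.map TLTerm.flip (fun _ _ h => TLTerm.Rel.flip h) f

theorem flip_id (X : TLBar R q) : flip (𝟙 X) = 𝟙 X := rfl

theorem flip_comp {X Y Z : TLBar R q} (f : X ⟶ Y) (g : Y ⟶ Z) :
    flip (f ≫ g) = flip g ≫ flip f := by
  rcases f with ⟨f⟩; rcases g with ⟨g⟩; rfl

theorem flip_tensorHom {X Y X' Y' : TLBar R q} (f : X ⟶ Y) (g : X' ⟶ Y') :
    flip (tensorHom f g) = tensorHom (flip f) (flip g) := by
  rcases f with ⟨f⟩; rcases g with ⟨g⟩; rfl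

theorem flip_flip {X Y : TLBar R q} (f : X ⟶ Y) : flip (flip f) = f := by
  rcases f with ⟨f⟩
  exact congrArg (mkHom q) f.flip_flip

theorem cup_comp_cap : cup q ≫ cap q = (q ^ 2 + 1) • 𝟙 _ := Quotient.sound .circle

theorem tensorHom_zero {X Y X' Y' : TLBar R q} (f : X ⟶ Y) :
    tensorHom f (0 : X' ⟶ Y') = 0 := MonoidalPreadditive.tensor_zero f

theorem zero_tensorHom {X Y X' Y' : TLBar R q} (g : X' ⟶ Y') :
    tensorHom (0 : X ⟶ Y) g = 0 := MonoidalPreadditive.zero_tensor g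

/-- Adding a strand on the right. -/
def strand {p p' : ℕ} (f : (⟨p⟩ : TLBar R q) ⟶ ⟨p'⟩) : (⟨p + 1⟩ : TLBar R q) ⟶ ⟨p' + 1⟩ :=
  tensorHom f (𝟙 (⟨1⟩ : TLBar R q))

/-- A cup to the right of `p` strands. -/
def cupAt (q : R) (p : ℕ) : (⟨p⟩ : TLBar R q) ⟶ ⟨p + 2⟩ := tensorHom (𝟙 (⟨p⟩ : TLBar R q)) (cup q)

/-- A cap to the right of `p` strands. -/
def capAt (q : R) (p : ℕ) : (⟨p + 2⟩ : TLBar R q) ⟶ ⟨p⟩ := tensorHom (𝟙 (⟨p⟩ : TLBar R q)) (cap q)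

theorem zigzag_left : cupAt q 1 ≫ strand (cap q) = q • 𝟙 _ := Quotient.sound .zigzag_left

theorem flip_strand {p p' : ℕ} (f : (⟨p⟩ : TLBar R q) ⟶ ⟨p'⟩) :
    flip (strand f) = strand (flip f) := flip_tensorHom _ _

theorem strand_id (p : ℕ) : strand (𝟙 (⟨p⟩ : TLBar R q)) = 𝟙 _ := tensorHom_id _ _

theorem strand_zero (p p' : ℕ) : strand (0 : (⟨p⟩ : TLBar R q) ⟶ ⟨p'⟩) = 0 := zero_tensorHom _

theorem strand_comp {p p' p'' : ℕ} (f : (⟨p⟩ : TLBar R q) ⟶ ⟨p'⟩)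
    (g : (⟨p'⟩ : TLBar R q) ⟶ ⟨p''⟩) : strand (f ≫ g) = strand f ≫ strand g := by
  have := tensorHom_comp f (𝟙 (⟨1⟩ : TLBar R q)) g (𝟙 (⟨1⟩ : TLBar R q))
  rwa [Category.comp_id] at this

/-- Associativity of the tensor product where it is a strict equality of objects. -/
theorem tensorHom_strand {s s' p p' : ℕ} (f : (⟨s⟩ : TLBar R q) ⟶ ⟨s'⟩)
    (g : (⟨p⟩ : TLBar R q) ⟶ ⟨p'⟩) :
    tensorHom f (strand g) = (strand (tensorHom f g) : (⟨s + p + 1⟩ : TLBar R q) ⟶ _) := by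
  have h := tensorHom_assoc f g (𝟙 (⟨1⟩ : TLBar R q))
  erw [eqToHom_refl, eqToHom_refl, Category.comp_id, Category.id_comp] at h
  exact h.symm

theorem strand_strand {p p' : ℕ} (f : (⟨p⟩ : TLBar R q) ⟶ ⟨p'⟩) :
    strand (strand f) = tensorHom f (𝟙 (⟨2⟩ : TLBar R q)) := by
  rw [← strand_id 1]
  exact (tensorHom_strand f (𝟙 _)).symm

theorem tensorHom_cupAt (s p : ℕ) :
    tensorHom (𝟙 (⟨s⟩ : TLBar R q)) (cupAt q p) = (cupAt q (s + p) : (⟨s + p⟩ : TLBar R q) ⟶ _) := by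
  have h := tensorHom_assoc (𝟙 (⟨s⟩ : TLBar R q)) (𝟙 (⟨p⟩ : TLBar R q)) (cup q)
  erw [eqToHom_refl, eqToHom_refl, Category.comp_id, Category.id_comp, tensorHom_id] at h
  exact h.symm

theorem tensorHom_capAt (s p : ℕ) :
    tensorHom (𝟙 (⟨s⟩ : TLBar R q)) (capAt q p) = (capAt q (s + p) : (⟨s + p + 2⟩ : TLBar R q) ⟶ _) := by
  have h := tensorHom_assoc (𝟙 (⟨s⟩ : TLBar R q)) (𝟙 (⟨p⟩ : TLBar R q)) (cap q)
  erw [eqToHom_refl, eqToHom_refl, Category.comp_id, Category.id_comp, tensorHom_id] at h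
  exact h.symm

theorem cupAt_zero : cupAt q 0 = cup q := by
  have h := unit_tensorHom (cup q)
  -- For these numerals `0 + 0` and `0 + 2` reduce by computation, so the unit isomorphisms are
  -- identities.
  erw [eqToHom_refl, eqToHom_refl, Category.comp_id, Category.id_comp] at h
  exact h

theorem capAt_zero : capAt q 0 = cap q := by
  have h := unit_tensorHom (cap q)
  erw [eqToHom_refl, eqToHom_refl, Category.comp_id, Category.id_comp] at h
  exact h

/-- By the interchange law, a cup on the far right slides past whatever happens on its left. -/
theorem comp_cupAt {p p' : ℕ} (f : (⟨p⟩ : TLBar R q) ⟶ ⟨p'⟩) :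
    f ≫ cupAt q p' = cupAt q p ≫ strand (strand f) := by
  have h := tensorHom_comp f (𝟙 _) (𝟙 _) (cup q)
  have h' := tensorHom_comp (𝟙 _) (cup q) f (𝟙 _)
  rw [Category.comp_id, Category.id_comp, tensorHom_unit] at h
  rw [Category.comp_id, Category.id_comp] at h'
  rw [strand_strand]
  exact h.symm.trans h'

theorem strand_strand_comp_capAt {p p' : ℕ} (f : (⟨p⟩ : TLBar R q) ⟶ ⟨p'⟩) :
    strand (strand f) ≫ capAt q p' = capAt q p ≫ f := by
  have h := tensorHom_comp (𝟙 _) (cap q) f (𝟙 _)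
  have h' := tensorHom_comp f (𝟙 _) (𝟙 _) (cap q)
  rw [Category.comp_id, Category.id_comp, tensorHom_unit] at h
  rw [Category.comp_id, Category.id_comp] at h'
  rw [strand_strand]
  exact h'.symm.trans h

end TLBar

namespace TL0

open TLBar

variable {k : Type u} [CommRing k]

theorem cupAt_comp_capAt (p : ℕ) : cupAt (0 : k) p ≫ capAt 0 p = 𝟙 _ := by
  have h := tensorHom_comp (𝟙 (⟨p⟩ : TL0 k)) (cup 0) (𝟙 _) (cap 0)
  rw [cup_comp_cap, Category.comp_id] at h
  simp only [ne_eq, OfNat.ofNat_ne_zero, not_false_eq_true, zero_pow, zero_add, one_smul] at h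
  exact h.symm.trans (tensorHom_id _ _)

theorem cupAt_comp_strand_capAt (p : ℕ) : cupAt (0 : k) (p + 1) ≫ strand (capAt 0 p) = 0 := by
  -- This is the basic zig-zag with p further strands on its left. The cap is written as `capAt 0 0`
  -- so that `tensorHom_capAt` absorbs these strands.
  have h := tensorHom_comp (𝟙 (⟨p⟩ : TL0 k)) (cupAt (0 : k) 1) (𝟙 _) (strand (capAt 0 0))
  have hz : cupAt (0 : k) 1 ≫ strand (capAt 0 0) = 0 := by
    rw [capAt_zero]
    exact (zigzag_left (q := (0 : k))).trans (hom_zero_smul _)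
  rw [hz, tensorHom_zero, tensorHom_strand, tensorHom_cupAt, tensorHom_capAt] at h
  exact h.symm

theorem strand_cupAt_comp_capAt (p : ℕ) : strand (cupAt (0 : k) p) ≫ capAt 0 (p + 1) = 0 := by
  have h := congrArg TLBar.flip (cupAt_comp_strand_capAt (k := k) p)
  rw [flip_comp, flip_strand] at h
  exact h

end TL0

/-! ### Decomposition into layers, and the normal form -/

namespace TL0

open TLBar

variable {k : Type u} [CommRing k]

namespace Generated

variable {useCup useCap : Prop}

theorem strand {p p' : ℕ} {f : (⟨p⟩ : TL0 k) ⟶ ⟨p'⟩} (hf : Generated k useCup useCap f) :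
    Generated k useCup useCap (strand f) :=
  hf.tensor (.id ⟨1⟩)

theorem cupAt (p : ℕ) (h : useCup) : Generated k useCup useCap (cupAt 0 p) :=
  .tensor (.id ⟨p⟩) (.cup h)

theorem capAt (p : ℕ) (h : useCap) : Generated k useCup useCap (capAt 0 p) :=
  .tensor (.id ⟨p⟩) (.cap h)

theorem flip {X Y : TL0 k} {f : X ⟶ Y} (hf : Generated k useCup useCap f) :
    Generated k useCap useCup (flip f) := by
  induction hf with
  | id X => exact .id X
  | cup h => exact .cap h
  | cap h => exact .cup h
  | comp _ _ ih ih' => rw [flip_comp]; exact ih'.comp ih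
  | tensor _ _ ih ih' => 
    rw [show TLBar.flip (_ ⊗ₘ _) = TLBar.flip _ ⊗ₘ TLBar.flip _ from flip_tensorHom _ _]
    exact ih.tensor ih'

theorem mono {useCup' useCap' : Prop} (h : useCup → useCup') (h' : useCap → useCap')
    {X Y : TL0 k} {f : X ⟶ Y} (hf : Generated k useCup useCap f) :
    Generated k useCup' useCap' f := by
  induction hf with
  | id X => exact .id X
  | cup hc => exact .cup (h hc)
  | cap hc => exact .cap (h' hc)
  | comp _ _ ih ih' => exact ih.comp ih'
  | tensor _ _ ih ih' => exact ih.tensor ih'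

end Generated

/-- A single cup or cap with vertical strands on both sides. -/
inductive Layer (k : Type u) [CommRing k] (useCup useCap : Prop) :
    ∀ {p p' : ℕ}, ((⟨p⟩ : TL0 k) ⟶ ⟨p'⟩) → Prop
  | cup (p : ℕ) (h : useCup) : Layer k useCup useCap (cupAt 0 p)
  | cap (p : ℕ) (h : useCap) : Layer k useCup useCap (capAt 0 p)
  | strand {p p' : ℕ} {f : (⟨p⟩ : TL0 k) ⟶ ⟨p'⟩} (hf : Layer k useCup useCap f) :
      Layer k useCup useCap (strand f)

/-- Compositions of layers. -/
inductive Layered (k : Type u) [CommRing k] (useCup useCap : Prop) :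
    ∀ {p p' : ℕ}, ((⟨p⟩ : TL0 k) ⟶ ⟨p'⟩) → Prop
  | id (p : ℕ) : Layered k useCup useCap (𝟙 (⟨p⟩ : TL0 k))
  | comp_layer {p p' p'' : ℕ} {f : (⟨p⟩ : TL0 k) ⟶ ⟨p'⟩} {g : (⟨p'⟩ : TL0 k) ⟶ ⟨p''⟩}
      (hf : Layered k useCup useCap f) (hg : Layer k useCup useCap g) :
      Layered k useCup useCap (f ≫ g)

variable {useCup useCap : Prop}

theorem Layer.generated {p p' : ℕ} {f : (⟨p⟩ : TL0 k) ⟶ ⟨p'⟩} (hf : Layer k useCup useCap f) :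
    Generated k useCup useCap f := by
  induction hf with
  | cup p h => exact .cupAt p h
  | cap p h => exact .capAt p h
  | strand _ ih => exact ih.strand

theorem Layer.cup_or_cap {p p' : ℕ} {f : (⟨p⟩ : TL0 k) ⟶ ⟨p'⟩} (hf : Layer k True True f) :
    Layer k True False f ∨ Layer k False True f := by
  induction hf with
  | cup p _ => exact .inl (.cup p trivial)
  | cap p _ => exact .inr (.cap p trivial)
  | strand _ ih => exact ih.imp .strand .strand

/-- Layers are built up from the right, so strands added on the left have to be carried by
associativity to the innermost cup or cap. -/
theorem Layer.tensorHom_left (s : ℕ) {p p' : ℕ} {f : (⟨p⟩ : TL0 k) ⟶ ⟨p'⟩}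
    (hf : Layer k useCup useCap f) :
    Layer k useCup useCap (TLBar.tensorHom (𝟙 (⟨s⟩ : TL0 k)) f) := by
  induction hf with
  | cup p h => exact tensorHom_cupAt (q := (0 : k)) s p ▸ .cup _ h
  | cap p h => exact tensorHom_capAt (q := (0 : k)) s p ▸ .cap _ h
  | strand _ ih => rw [tensorHom_strand]; exact ih.strand

namespace Layered

theorem layer {p p' : ℕ} {f : (⟨p⟩ : TL0 k) ⟶ ⟨p'⟩} (hf : Layer k useCup useCap f) :
    Layered k useCup useCap f :=
  Category.id_comp f ▸ (Layered.id p).comp_layer hf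

theorem comp {p p' p'' : ℕ} {f : (⟨p⟩ : TL0 k) ⟶ ⟨p'⟩} {g : (⟨p'⟩ : TL0 k) ⟶ ⟨p''⟩}
    (hf : Layered k useCup useCap f) (hg : Layered k useCup useCap g) :
    Layered k useCup useCap (f ≫ g) := by
  induction hg with
  | id => rwa [Category.comp_id]
  | comp_layer _ h ih => rw [← Category.assoc]; exact ih.comp_layer h

theorem strand {p p' : ℕ} {f : (⟨p⟩ : TL0 k) ⟶ ⟨p'⟩} (hf : Layered k useCup useCap f) :
    Layered k useCup useCap (strand f) := by
  induction hf with
  | id => rw [strand_id]; exact .id (p + 1)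
  | comp_layer _ h ih => rw [strand_comp]; exact ih.comp_layer h.strand

theorem tensorHom_right (s : ℕ) {p p' : ℕ} {f : (⟨p⟩ : TL0 k) ⟶ ⟨p'⟩}
    (hf : Layered k useCup useCap f) :
    Layered k useCup useCap (TLBar.tensorHom f (𝟙 (⟨s⟩ : TL0 k))) := by
  induction s with
  | zero => exact (tensorHom_unit f).symm ▸ hf
  | succ s ih =>
    rw [← strand_id, tensorHom_strand]
    exact ih.strand

theorem tensorHom_left (s : ℕ) {p p' : ℕ} {f : (⟨p⟩ : TL0 k) ⟶ ⟨p'⟩}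
    (hf : Layered k useCup useCap f) :
    Layered k useCup useCap (TLBar.tensorHom (𝟙 (⟨s⟩ : TL0 k)) f) := by
  induction hf with
  | id => exact (tensorHom_id (⟨s⟩ : TL0 k) ⟨p⟩).symm ▸ .id (s + p)
  | comp_layer _ h ih =>
    rw [← Category.comp_id (𝟙 (⟨s⟩ : TL0 k)), tensorHom_comp]
    exact ih.comp_layer (h.tensorHom_left s)

end Layered

/-- A tensor product f ⊗ g factors as (f ⊗ 1) followed by (1 ⊗ g), so composition and strands
suffice. -/
theorem Generated.layered {X Y : TL0 k} {f : X ⟶ Y} (hf : Generated k useCup useCap f) :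
    Layered k useCup useCap (p := X.n) (p' := Y.n) f := by
  induction hf with
  | id X => exact .id X.n
  | cup h => exact cupAt_zero (q := (0 : k)) ▸ .layer (.cup 0 h)
  | cap h => exact capAt_zero (q := (0 : k)) ▸ .layer (.cap 0 h)
  | comp _ _ ih ih' => exact ih.comp ih'
  | @tensor X Y X' Y' f g _ _ ih ih' =>
    have h := tensorHom_comp f (𝟙 X') (𝟙 Y) g
    rw [Category.comp_id, Category.id_comp] at h
    change Layered k _ _ (TLBar.tensorHom f g)
    rw [h]
    exact (ih.tensorHom_right X'.n).comp (ih'.tensorHom_left Y.n)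

/-- The cup diagram in which the matched pairs of a ballot word are joined by cups. -/
def cupDiagram (k : Type u) [CommRing k] : ∀ {n l : ℕ}, Ballot n l → ((⟨l⟩ : TL0 k) ⟶ ⟨n⟩)
  | _, _, .nil => 𝟙 _
  | _, _, .up a => strand (cupDiagram k a)
  -- The right leg of the new cup runs straight to the last point; the left leg enters `a` as its
  -- last unmatched letter.
  | _, l, .down a => cupAt 0 l ≫ strand (cupDiagram k a)

theorem generated_cupDiagram {n l : ℕ} (a : Ballot n l) :
    Generated k True False (cupDiagram k a) := by
  induction a with
  | nil => exact .id _
  | up a ih => exact ih.strand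
  | down a ih => exact (Generated.cupAt _ trivial).comp ih.strand

theorem exists_cupDiagram_eq_id (n : ℕ) : ∃ a : Ballot n n, cupDiagram k a = 𝟙 _ := by
  induction n with
  | zero => exact ⟨.nil, rfl⟩
  | succ n ih =>
    obtain ⟨a, ha⟩ := ih
    exact ⟨.up a, by rw [cupDiagram, ha, strand_id]⟩

/-- A further cup inserts an adjacent matched pair into the word. At the right end it is appended
there; otherwise the last letter of the word is peeled off. -/
theorem exists_cupDiagram_comp_layer {n n' l : ℕ} (a : Ballot n l) {f : (⟨n⟩ : TL0 k) ⟶ ⟨n'⟩}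
    (hf : Layer k True False f) :
    ∃ a' : Ballot n' l, cupDiagram k a ≫ f = cupDiagram k a' := by
  induction hf generalizing l with
  | cup p _ => exact ⟨.down (.up a), comp_cupAt _⟩
  | cap p h => exact h.elim
  | strand _ ih =>
    cases a with
    | up a =>
      obtain ⟨a', h⟩ := ih a
      exact ⟨.up a', by simp only [cupDiagram, ← h, strand_comp]⟩
    | down a =>
      obtain ⟨a', h⟩ := ih a
      exact ⟨.down a', by simp only [cupDiagram, ← h, strand_comp, Category.assoc]⟩

theorem Generated.exists_eq_cupDiagram {X Y : TL0 k} {f : X ⟶ Y} (hf : Generated k True False f) :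
    ∃ a : Ballot Y.n X.n, f = cupDiagram k a := by
  have h := hf.layered
  clear hf
  obtain ⟨p⟩ := X
  obtain ⟨p'⟩ := Y
  dsimp only at h ⊢
  induction h with
  | id =>
    obtain ⟨a, ha⟩ := exists_cupDiagram_eq_id (k := k) _
    exact ⟨a, ha.symm⟩
  | comp_layer _ hg ih =>
    obtain ⟨a, rfl⟩ := ih
    exact exists_cupDiagram_comp_layer a hg

theorem Generated.exists_eq_flip_cupDiagram {X Y : TL0 k} {f : X ⟶ Y}
    (hf : Generated k False True f) :
    ∃ a : Ballot X.n Y.n, f = TLBar.flip (cupDiagram k a) := by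
  obtain ⟨a, ha⟩ := hf.flip.exists_eq_cupDiagram
  exact ⟨a, by rw [← flip_flip f, ha]⟩

/-- A cap layer below a cup diagram either kills it, or removes a cup, or can be moved past it. -/
theorem cupDiagram_comp_capLayer {n n' l : ℕ} (a : Ballot n l) {f : (⟨n⟩ : TL0 k) ⟶ ⟨n'⟩}
    (hf : Layer k False True f) :
    cupDiagram k a ≫ f = 0 ∨ (∃ a' : Ballot n' l, cupDiagram k a ≫ f = cupDiagram k a') ∨
      ∃ (l' : ℕ) (f' : (⟨l⟩ : TL0 k) ⟶ ⟨l'⟩) (a' : Ballot n' l'), Layer k False True f' ∧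
        cupDiagram k a ≫ f = f' ≫ cupDiagram k a' := by
  induction hf generalizing l with
  | cup p h => exact h.elim
  | cap p _ =>
    rcases a with _ | @⟨_, l, a⟩ | @⟨_, _, a⟩
    · rcases a with _ | a | a
      -- The cap joins two through strands and slides past all the cups.
      · exact .inr (.inr ⟨_, _, a, .cap _ trivial, strand_strand_comp_capAt _⟩)
      -- The cap joins a through strand to the right leg of a cup: a zig-zag.
      · left
        simp only [cupDiagram, strand_comp, Category.assoc, strand_strand_comp_capAt]
        rw [← Category.assoc, strand_cupAt_comp_capAt, Limits.zero_comp]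
    · rcases a with _ | a | a
      -- The last two letters are matched with each other, so the cap closes their cup to a circle.
      · refine .inr (.inl ⟨a, ?_⟩)
        simp only [cupDiagram, Category.assoc, strand_strand_comp_capAt]
        rw [← Category.assoc, cupAt_comp_capAt, Category.id_comp]
      -- The cap joins the right legs of two nested cups, again a zig-zag.
      · left
        simp only [cupDiagram, strand_comp, Category.assoc, strand_strand_comp_capAt]
        rw [← Category.assoc (strand _), strand_cupAt_comp_capAt, Limits.zero_comp,
          Limits.comp_zero]
  | strand _ ih =>
    rcases a with _ | a | a
    · rcases ih a with h | ⟨a', h⟩ | ⟨l', f', a', hf', h⟩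
      · left; rw [cupDiagram, ← strand_comp, h, strand_zero]
      · exact .inr (.inl ⟨.up a', by rw [cupDiagram, ← strand_comp, h, cupDiagram]⟩)
      · exact .inr (.inr ⟨_, _, .up a', hf'.strand, by
          rw [cupDiagram, ← strand_comp, h, strand_comp, cupDiagram]⟩)
    · rcases ih a with h | ⟨a', h⟩ | ⟨l', f', a', hf', h⟩
      · left; rw [cupDiagram, Category.assoc, ← strand_comp, h, strand_zero, Limits.comp_zero]
      · exact .inr (.inl ⟨.down a', by
          rw [cupDiagram, Category.assoc, ← strand_comp, h, cupDiagram]⟩)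
      · rw [cupDiagram, Category.assoc, ← strand_comp, h, strand_comp, ← Category.assoc]
        -- The cap has passed through `a` and now meets the cup that ends at the last point. It
        -- either uses the left leg of that cup, which is a zig-zag, or lies entirely to the left
        -- and slides past.
        rcases hf' with ⟨_, hc⟩ | ⟨_, _⟩ | hf'
        · exact hc.elim
        · left; rw [cupAt_comp_strand_capAt, Limits.zero_comp]
        · refine .inr (.inr ⟨_, _, .down a', hf', ?_⟩)
          rw [← comp_cupAt, Category.assoc, cupDiagram]

/-- The diagram with caps prescribed by one ballot word, followed by cups prescribed by another. -/
def diagram (k : Type u) [CommRing k] {m n : ℕ} (p : BallotPair m n) : (⟨m⟩ : TL0 k) ⟶ ⟨n⟩ :=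
  TLBar.flip (cupDiagram k p.2.1) ≫ cupDiagram k p.2.2

theorem generated_diagram {m n : ℕ} (p : BallotPair m n) :
    Generated k True True (diagram k p) :=
  ((generated_cupDiagram _).flip.mono False.elim id).comp
    ((generated_cupDiagram _).mono id False.elim)

/-- Layers are multiplied on one at a time to a product already in normal form. A cup joins the cups
at the end, while a cap is pushed back through them. -/
theorem Generated.eq_zero_or_exists_eq_diagram {X Y : TL0 k} {f : X ⟶ Y}
    (hf : Generated k True True f) : f = 0 ∨ ∃ p : BallotPair X.n Y.n, f = diagram k p := by
  have h := hf.layered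
  clear hf
  obtain ⟨m⟩ := X
  obtain ⟨n⟩ := Y
  dsimp only at h ⊢
  induction h with
  | id =>
    obtain ⟨a, ha⟩ := exists_cupDiagram_eq_id (k := k) _
    refine .inr ⟨⟨_, a, a⟩, ?_⟩
    rw [diagram, ha, flip_id, Category.comp_id]
  | @comp_layer _ _ f g _ hg ih =>
    rcases ih with rfl | ⟨⟨l, b, a⟩, rfl⟩
    · left; exact Limits.zero_comp
    rcases hg.cup_or_cap with hg | hg
    · obtain ⟨a', h⟩ := exists_cupDiagram_comp_layer a hg
      exact .inr ⟨⟨l, b, a'⟩, by rw [diagram, Category.assoc, h, diagram]⟩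
    · rcases cupDiagram_comp_capLayer a hg with h | ⟨a', h⟩ | ⟨l', g', a', hg', h⟩
      · left; rw [diagram, Category.assoc, h, Limits.comp_zero]
      · exact .inr ⟨⟨l, b, a'⟩, by rw [diagram, Category.assoc, h, diagram]⟩
      -- The cap that came through merges with the earlier caps: a product of caps alone is the
      -- reflection of a cup diagram.
      · obtain ⟨b', hb'⟩ :=
          ((generated_cupDiagram b).flip.comp hg'.generated).exists_eq_flip_cupDiagram
        exact .inr ⟨⟨l', b', a'⟩, by rw [diagram, Category.assoc, h, ← Category.assoc, hb', diagram]⟩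

theorem span_generated_eq_top (X Y : TL0 k) :
    Submodule.span k {f : X ⟶ Y | Generated k True True f} = ⊤ := by
  suffices h : ∀ {m n : ℕ} (t : TLTerm k m n), mkHom (0 : k) t ∈
      Submodule.span k {f : (⟨m⟩ : TL0 k) ⟶ ⟨n⟩ | Generated k True True f} by
    rw [eq_top_iff]
    rintro ⟨t⟩ -
    exact h t
  intro m n t
  induction t with
  | id n => exact Submodule.subset_span (.id ⟨n⟩)
  | cup => exact Submodule.subset_span (.cup trivial)
  | cap => exact Submodule.subset_span (.cap trivial)
  | zero => exact Submodule.zero_mem _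
  | add f g ihf ihg => exact Submodule.add_mem _ ihf ihg
  | smul r f ih => exact Submodule.smul_mem _ r ih
  | comp f g ihf ihg =>
    change mkHom 0 f ≫ mkHom 0 g ∈ _
    generalize mkHom (0 : k) f = x, mkHom (0 : k) g = y at ihf ihg
    induction ihf using Submodule.span_induction with
    | mem x hx =>
      induction ihg using Submodule.span_induction with
      | mem y hy => exact Submodule.subset_span (hx.comp hy)
      | zero => rw [Limits.comp_zero]; exact Submodule.zero_mem _
      | add y z _ _ hy hz => rw [Preadditive.comp_add]; exact Submodule.add_mem _ hy hz
      | smul r y _ hy => rw [Linear.comp_smul]; exact Submodule.smul_mem _ r hy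
    | zero => rw [Limits.zero_comp]; exact Submodule.zero_mem _
    | add y z _ _ hy hz => rw [Preadditive.add_comp]; exact Submodule.add_mem _ hy hz
    | smul r y _ hy => rw [Linear.smul_comp]; exact Submodule.smul_mem _ r hy
  | tensor f g ihf ihg =>
    change mkHom 0 f ⊗ₘ mkHom 0 g ∈ _
    generalize mkHom (0 : k) f = x, mkHom (0 : k) g = y at ihf ihg
    induction ihf using Submodule.span_induction with
    | mem x hx =>
      induction ihg using Submodule.span_induction with
      | mem y hy => exact Submodule.subset_span (hx.tensor hy)
      | zero => rw [MonoidalPreadditive.tensor_zero]; exact Submodule.zero_mem _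
      | add y z _ _ hy hz => rw [MonoidalPreadditive.tensor_add]; exact Submodule.add_mem _ hy hz
      | smul r y _ hy =>
        rw [MonoidalCategory.tensorHom_def, MonoidalLinear.whiskerLeft_smul, Linear.comp_smul, ← MonoidalCategory.tensorHom_def]
        exact Submodule.smul_mem _ r hy
    | zero => rw [MonoidalPreadditive.zero_tensor]; exact Submodule.zero_mem _
    | add y z _ _ hy hz => rw [MonoidalPreadditive.add_tensor]; exact Submodule.add_mem _ hy hz
    | smul r y _ hy =>
      rw [MonoidalCategory.tensorHom_def, MonoidalLinear.smul_whiskerRight, Linear.smul_comp, ← MonoidalCategory.tensorHom_def]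
      exact Submodule.smul_mem _ r hy

end TL0

/-! ### The action on tensor powers of a free module of rank two -/

/-- The words of length `n` in two letters. -/
noncomputable def boolWords (n : ℕ) : Finset (List Bool) := (List.finite_length_eq Bool n).toFinset

theorem mem_boolWords {n : ℕ} {x : List Bool} : x ∈ boolWords n ↔ x.length = n := by
  simp [boolWords]

/-- This is the summation behind the interchange law. Since words are listed from right to left, the
left tensor factor sees the tail of the list. -/
theorem sum_boolWords_add {M : Type*} [AddCommMonoid M] (m n : ℕ)
    (f : List Bool → List Bool → M) :
    ∑ y ∈ boolWords m, ∑ z ∈ boolWords n, f y z =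
      ∑ w ∈ boolWords (m + n), f (w.drop n) (w.take n) := by
  rw [← Finset.sum_product']
  refine Finset.sum_bij' (fun p _ => p.2 ++ p.1) (fun w _ => (w.drop n, w.take n)) ?_ ?_ ?_ ?_ ?_
  all_goals
    simp only [Finset.mem_product, mem_boolWords, Prod.forall]
    intros
    simp_all
  all_goals omega

namespace TLTerm

/-- The matrix entries of the action of an expression on the tensor powers of a free module with
basis `e true`, `e false`, in which `cup` is `e true ⊗ e false` and `cap` is the dual functional.
The letters of words are listed from right to left. -/
noncomputable def entry {R : Type u} [CommRing R] :
    ∀ {m n : ℕ}, TLTerm R m n → List Bool → List Bool → R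
  | _, _, id _, x, y => if x = y then 1 else 0
  | _, _, cup, _, y => if y = [false, true] then 1 else 0
  | _, _, cap, x, _ => if x = [false, true] then 1 else 0
  | _, _, comp (m := m) f g, x, z => ∑ y ∈ boolWords m, f.entry x y * g.entry y z
  | _, _, tensor (m' := m') (n' := n') f g, x, y =>
    f.entry (x.drop m') (y.drop n') * g.entry (x.take m') (y.take n')
  | _, _, zero _ _, _, _ => 0
  | _, _, add f g, x, y => f.entry x y + g.entry x y
  | _, _, smul r f, x, y => r * f.entry x y

variable {R : Type u} [CommRing R]

theorem entry_cast {m m' n n' : ℕ} (hm : m = m') (hn : n = n') (f : TLTerm R m n) :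
    (cast hm hn f).entry = f.entry := by
  subst hm; subst hn; rfl

/-- Matrix product and Kronecker product satisfy the axioms, so only the zig-zags and the circle
need thought. This makes matrix entries well defined on morphisms. -/
theorem Rel.entry_eq {m n : ℕ} {f g : TLTerm R m n} (h : Rel 0 f g) {x y : List Bool}
    (hx : x.length = m) (hy : y.length = n) : f.entry x y = g.entry x y := by
  induction h generalizing x y with
  | refl => rfl
  | symm _ ih => exact (ih hx hy).symm
  | trans _ _ ih ih' => exact (ih hx hy).trans (ih' hx hy)
  | comp_congr _ _ ih ih' =>
    refine Finset.sum_congr rfl fun z hz => ?_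
    rw [ih hx (mem_boolWords.1 hz), ih' (mem_boolWords.1 hz) hy]
  | tensor_congr _ _ ih ih' =>
    simp only [entry]
    rw [ih (by simp [hx]) (by simp [hy]), ih' (by simp [hx]) (by simp [hy])]
  | add_congr _ _ ih ih' => simp only [entry, ih hx hy, ih' hx hy]
  | smul_congr r _ ih => simp only [entry, ih hx hy]
  | id_comp => simp [entry, mem_boolWords, hx]
  | comp_id => simp [entry, mem_boolWords, hy]
  | assoc =>
    simp only [entry, Finset.sum_mul, Finset.mul_sum]
    rw [Finset.sum_comm]
    simp only [mul_assoc]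
  | add_assoc => simp only [entry, _root_.add_assoc]
  | add_comm => simp only [entry, _root_.add_comm]
  | zero_add => simp only [entry, _root_.zero_add]
  | smul_add => simp only [entry, mul_add]
  | add_smul => simp only [entry, add_mul]
  | mul_smul => simp only [entry, mul_assoc]
  | one_smul => simp only [entry, one_mul]
  | zero_smul => simp only [entry, zero_mul]
  | add_comp => simp only [entry, add_mul, Finset.sum_add_distrib]
  | comp_add => simp only [entry, mul_add, Finset.sum_add_distrib]
  | smul_comp => simp only [entry, Finset.mul_sum, mul_assoc]
  | comp_smul => simp only [entry, Finset.mul_sum, mul_left_comm]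
  | add_tensor => simp only [entry, add_mul]
  | tensor_add => simp only [entry, mul_add]
  | smul_tensor => simp only [entry, mul_assoc]
  | tensor_smul => simp only [entry, mul_left_comm]
  | id_tensor_id m n =>
    have : x = y ↔ x.drop n = y.drop n ∧ x.take n = y.take n := by
      refine ⟨fun h => h ▸ ⟨rfl, rfl⟩, fun h => ?_⟩
      rw [← List.take_append_drop n x, h.1, h.2, List.take_append_drop]
    simp only [entry, this, ite_and, mul_ite, mul_one, mul_zero]
    split_ifs <;> rfl
  | @interchange l m n l' m' n' f g f' g' =>
    simp only [entry, Finset.sum_mul_sum, mul_mul_mul_comm (f.entry _ _)]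
    exact sum_boolWords_add _ _ fun z w =>
      f.entry (x.drop l') z * g.entry z (y.drop n') *
        (f'.entry (x.take l') w * g'.entry w (y.take n'))
  | tensor_assoc =>
    rw [entry_cast]
    simp only [entry, List.drop_drop, List.take_take, List.take_drop, mul_assoc]
    simp [Nat.add_comm]
  | unit_tensor =>
    rw [entry_cast]
    simp [entry, ← hx, ← hy]
  | tensor_unit =>
    rw [entry_cast]
    simp [entry]
  | zigzag_left =>
    simp only [entry, zero_mul]
    refine Finset.sum_eq_zero fun w hw => ?_
    obtain ⟨a, b, c, rfl⟩ := List.length_eq_three.1 (mem_boolWords.1 hw)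
    -- The middle letter is the left leg of one arc, which demands `true`, and the right leg of the
    -- other, which demands `false`.
    cases b <;> simp
  | zigzag_right =>
    simp only [entry, zero_mul]
    refine Finset.sum_eq_zero fun w hw => ?_
    obtain ⟨a, b, c, rfl⟩ := List.length_eq_three.1 (mem_boolWords.1 hw)
    cases b <;> simp
  | circle =>
    obtain rfl := List.length_eq_zero_iff.1 hx
    obtain rfl := List.length_eq_zero_iff.1 hy
    simp [entry, mem_boolWords]

theorem entry_flip {m n : ℕ} (f : TLTerm R m n) (x y : List Bool) :
    f.flip.entry y x = f.entry x y := by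
  induction f generalizing x y with
  | id => simp only [flip, entry, eq_comm]
  | comp f g ihf ihg => simp only [flip, entry, ihf, ihg, mul_comm]
  | _ => simp_all [flip, entry]

end TLTerm

namespace TL0

open TLBar

variable {k : Type u} [CommRing k]

/-- The matrix entries of a morphism, as linear functionals. -/
noncomputable def entry {X Y : TL0 k} (x : {x : List Bool // x.length = X.n})
    (y : {y : List Bool // y.length = Y.n}) : (X ⟶ Y) →ₗ[k] k where
  toFun := Quotient.lift (fun t => t.entry x.1 y.1) fun _ _ h => TLTerm.Rel.entry_eq h x.2 y.2
  map_add' := by rintro ⟨f⟩ ⟨g⟩; rfl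
  map_smul' := by rintro r ⟨f⟩; rfl

theorem entry_flip {X Y : TL0 k} (f : X ⟶ Y) (x : {x : List Bool // x.length = X.n})
    (y : {y : List Bool // y.length = Y.n}) : entry y x (flip f) = entry x y f := by
  rcases f with ⟨f⟩; exact f.entry_flip _ _

theorem entry_comp {X Y Z : TL0 k} (f : X ⟶ Y) (g : Y ⟶ Z)
    (x : {x : List Bool // x.length = X.n}) (z : {z : List Bool // z.length = Z.n}) :
    entry x z (f ≫ g) = ∑ y ∈ (boolWords Y.n).attach,
      entry x ⟨y.1, mem_boolWords.1 y.2⟩ f * entry ⟨y.1, mem_boolWords.1 y.2⟩ z g := by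
  rcases f with ⟨f⟩; rcases g with ⟨g⟩
  exact (Finset.sum_attach (boolWords Y.n) fun y => f.entry x.1 y * g.entry y z.1).symm

theorem entry_strand {p p' : ℕ} (f : (⟨p⟩ : TL0 k) ⟶ ⟨p'⟩) (c d : Bool) {x y : List Bool}
    (hx : (c :: x).length = p + 1) (hy : (d :: y).length = p' + 1) :
    entry ⟨c :: x, hx⟩ ⟨d :: y, hy⟩ (strand f) =
      if c = d then entry ⟨x, Nat.succ.inj hx⟩ ⟨y, Nat.succ.inj hy⟩ f else 0 := by
  rcases f with ⟨f⟩
  change f.entry x y * (if [c] = [d] then 1 else 0) = if c = d then f.entry x y else 0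
  simp

theorem entry_cupAt {p : ℕ} {x y : List Bool} (hx : x.length = p) (hy : y.length = p + 2) :
    entry ⟨x, hx⟩ ⟨y, hy⟩ (cupAt (0 : k) p) = if y = false :: true :: x then 1 else 0 := by
  change (if x = y.drop 2 then (1 : k) else 0) * (if y.take 2 = [false, true] then 1 else 0) = _
  obtain ⟨c, d, y, rfl⟩ : ∃ c d z, y = c :: d :: z := by
    match y, hy with
    | c :: d :: y, _ => exact ⟨c, d, y, rfl⟩
  by_cases h : x = y <;> simp [h, eq_comm]

end TL0

/-! ### Unitriangularity and linear independence -/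

namespace Ballot

/-- Insertion of the letters at the unmatched positions into a ballot word, where the matched
letters are kept. -/
def fill : ∀ {n l : ℕ}, Ballot n l → List Bool → List Bool
  | _, _, nil, x => x
  | _, _, up _, [] => []
  | _, _, up a, c :: x => c :: a.fill x
  -- The closing parenthesis is `false`; the `true` pushed onto `x` is its partner, filling the last
  -- unmatched position of `a`.
  | _, _, down a, x => false :: a.fill (true :: x)

theorem length_fill {n l : ℕ} (a : Ballot n l) {x : List Bool} (hx : x.length = l) :
    (a.fill x).length = n := by
  induction a generalizing x with
  | nil => exact hx
  | up a ih =>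
    match x, hx with
    | c :: x, hx => simp [fill, ih (Nat.succ.inj hx)]
  | down a ih => simp [fill, ih (x := true :: x) (by simp [hx])]

/-- Each matched pair contributes one letter of each kind, so filling preserves the excess of `true`
over `false`. The equation is arranged to avoid subtraction. -/
theorem count_fill {n l : ℕ} (a : Ballot n l) {x : List Bool} (hx : x.length = l) :
    (a.fill x).count true + x.count false = (a.fill x).count false + x.count true := by
  induction a generalizing x with
  | nil => simp [fill, add_comm]
  | up a ih =>
    match x, hx with
    | c :: x, hx =>
      have := ih (Nat.succ.inj hx)
      cases c <;> simp [fill] <;> omega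
  | down a ih =>
    have := ih (x := true :: x) (by simp [hx])
    simp [fill] at this ⊢
    omega

/-- The letters of a ballot word, from right to left. -/
def word {n l : ℕ} (a : Ballot n l) : List Bool := a.fill (List.replicate l true)

theorem length_word {n l : ℕ} (a : Ballot n l) : a.word.length = n := a.length_fill (by simp)

theorem word_injective {n l : ℕ} : Function.Injective (word : Ballot n l → List Bool) := by
  intro a b h
  induction a with
  | nil => cases b; rfl
  | up a ih =>
    cases b with
    | up b => simp [word, fill, List.replicate_succ] at h; rw [ih h]
    | down b => simp [word, fill, List.replicate_succ] at h
  | down a ih =>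
    cases b with
    | up b => simp [word, fill, List.replicate_succ] at h
    | down b =>
      simp only [word, fill, List.cons.injEq, true_and, ← List.replicate_succ] at h
      rw [ih h]

/-- The excess of `a.word` is l, while l' inserted letters produce an excess of at most l', attained
only when all of them are `true`. -/
theorem le_of_fill_eq_word {n l l' : ℕ} {a : Ballot n l} {a' : Ballot n l'} {x : List Bool}
    (hx : x.length = l') (h : a'.fill x = a.word) : l ≤ l' := by
  have h1 := a'.count_fill hx
  have h2 := a.count_fill (x := List.replicate l true) (by simp)
  rw [← word, ← h] at h2
  have h3 := x.count_le_length (a := true)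
  simp [List.count_replicate] at h2
  omega

theorem eq_replicate_of_fill_eq_word {n l : ℕ} {a a' : Ballot n l} {x : List Bool}
    (hx : x.length = l) (h : a'.fill x = a.word) : x = List.replicate l true := by
  have h1 := a'.count_fill hx
  have h2 := a.count_fill (x := List.replicate l true) (by simp)
  rw [← word, ← h] at h2
  have h3 := x.count_le_length (a := true)
  simp [List.count_replicate] at h2
  have h4 : x.count true = x.length := by omega
  rw [List.count_eq_length] at h4
  exact List.eq_replicate_iff.2 ⟨hx, fun c hc => (h4 c hc).symm⟩

theorem eq_of_fill_eq_word {n l : ℕ} {a a' : Ballot n l} {x : List Bool}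
    (hx : x.length = l) (h : a'.fill x = a.word) : a' = a := by
  obtain rfl := eq_replicate_of_fill_eq_word hx h
  exact word_injective h

end Ballot

namespace TL0

open TLBar

variable {k : Type u} [CommRing k]

/-- A cup diagram sends basis vectors to basis vectors, by filling the word. Only one intermediate
word survives the new cup in the `down` case. -/
theorem entry_cupDiagram {n l : ℕ} (a : Ballot n l) {x y : List Bool} (hx : x.length = l)
    (hy : y.length = n) :
    entry ⟨x, hx⟩ ⟨y, hy⟩ (cupDiagram k a) = if a.fill x = y then 1 else 0 := by
  induction a generalizing x y with
  | nil => rfl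
  | up a ih =>
    match x, y, hx, hy with
    | c :: x, d :: y, hx, hy =>
      rw [cupDiagram, entry_strand, ih]
      simp [Ballot.fill, ite_and]
  | @down n l a ih =>
    match y, hy with
    | d :: y, hy =>
      rw [cupDiagram, entry_comp]
      have hm : false :: true :: x ∈ boolWords (l + 2) := mem_boolWords.2 (by simp [hx])
      rw [Finset.sum_eq_single ⟨_, hm⟩]
      · rw [entry_cupAt, if_pos rfl, one_mul, entry_strand, ih]
        simp [Ballot.fill, ite_and]
      · intro b _ hb
        rw [entry_cupAt, if_neg fun h => hb (Subtype.ext h), zero_mul]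
      · intro h; exact absurd (Finset.mem_attach _ _) h

theorem entry_diagram {m n : ℕ} (p : BallotPair m n) {x y : List Bool} (hx : x.length = m)
    (hy : y.length = n) :
    entry ⟨x, hx⟩ ⟨y, hy⟩ (diagram k p) =
      ∑ z ∈ boolWords p.1, if p.2.1.fill z = x ∧ p.2.2.fill z = y then 1 else 0 := by
  rw [diagram, entry_comp, ← Finset.sum_attach (boolWords p.1)]
  refine Finset.sum_congr rfl fun z _ => ?_
  rw [entry_flip, entry_cupDiagram, entry_cupDiagram, ite_and, ite_mul, one_mul, zero_mul]

theorem entry_diagram_word_self {m n : ℕ} (p : BallotPair m n) :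
    entry ⟨p.2.1.word, p.2.1.length_word⟩ ⟨p.2.2.word, p.2.2.length_word⟩ (diagram k p) = 1 := by
  have hr : List.replicate p.1 true ∈ boolWords p.1 := mem_boolWords.2 (by simp)
  rw [entry_diagram, Finset.sum_eq_single_of_mem _ hr, if_pos ⟨rfl, rfl⟩]
  intro z hz hne
  exact if_neg fun h => hne (Ballot.eq_replicate_of_fill_eq_word (mem_boolWords.1 hz) h.1)

/-- A nonzero entry needs a filling of the words of `p'` that yields those of `p`. The excess rules
this out with fewer through strands, and with equally many it forces all inserted letters to be
`true`, hence `p' = p`. -/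
theorem entry_diagram_word {m n : ℕ} (p p' : BallotPair m n) (hne : p' ≠ p) (hle : p'.1 ≤ p.1) :
    entry ⟨p.2.1.word, p.2.1.length_word⟩ ⟨p.2.2.word, p.2.2.length_word⟩ (diagram k p') = 0 := by
  rw [entry_diagram]
  refine Finset.sum_eq_zero fun z hz => if_neg fun h => hne ?_
  rw [mem_boolWords] at hz
  have hl := le_antisymm hle (Ballot.le_of_fill_eq_word hz h.1)
  obtain ⟨l, b, a⟩ := p
  obtain ⟨l', b', a'⟩ := p'
  dsimp only at hl hz h
  subst hl
  rw [Ballot.eq_of_fill_eq_word hz h.1, Ballot.eq_of_fill_eq_word hz h.2]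

theorem linearIndependent_diagram (m n : ℕ) :
    LinearIndependent k (diagram k : BallotPair m n → ((⟨m⟩ : TL0 k) ⟶ ⟨n⟩)) := by
  have := Fintype.ofFinite (BallotPair m n)
  rw [Fintype.linearIndependent_iff]
  intro g hg
  -- Here d is the number of source points on caps. Strong induction on d treats the diagrams with
  -- most through strands first, disposing of the terms that the triangular vanishing does not
  -- reach.
  suffices h : ∀ d (p : BallotPair m n), m = p.1 + d → g p = 0 from
    fun p => h (m - p.1) p (by have := p.2.1.le; omega)
  intro d
  induction d using Nat.strong_induction_on with
  | _ d ih =>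
    intro p hp
    have h := congrArg
      (entry (k := k) (X := ⟨m⟩) (Y := ⟨n⟩) ⟨p.2.1.word, p.2.1.length_word⟩
        ⟨p.2.2.word, p.2.2.length_word⟩) hg
    rw [map_sum, map_zero, Finset.sum_eq_single p] at h
    · rwa [map_smul, entry_diagram_word_self, smul_eq_mul, mul_one] at h
    · intro p' _ hne
      rw [map_smul]
      rcases le_or_gt p'.1 p.1 with hle | hlt
      · rw [entry_diagram_word p p' hne hle, smul_zero]
      · have := p'.2.1.le
        rw [ih (m - p'.1) (by omega) p' (by omega), zero_smul]
    · simp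

end TL0

/-! ### Bases, dimensions and unique factorization -/

namespace TL0

open TLBar

section

variable {k : Type u} [CommRing k]

theorem IsDiagram.exists_eq_diagram {m n : ℕ} {x : (⟨m⟩ : TL0 k) ⟶ ⟨n⟩} (hx : IsDiagram x) :
    ∃ p : BallotPair m n, x = diagram k p :=
  hx.2.eq_zero_or_exists_eq_diagram.resolve_left hx.1

theorem span_range_diagram (m n : ℕ) :
    Submodule.span k (Set.range (diagram k : BallotPair m n → ((⟨m⟩ : TL0 k) ⟶ ⟨n⟩))) = ⊤ := by
  rw [eq_top_iff, ← span_generated_eq_top, Submodule.span_le]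
  intro f hf
  rcases Generated.eq_zero_or_exists_eq_diagram hf with rfl | ⟨p, rfl⟩
  · exact Submodule.zero_mem _
  · exact Submodule.subset_span ⟨p, rfl⟩

variable [Nontrivial k]

theorem diagram_injective (m n : ℕ) :
    Function.Injective (diagram k : BallotPair m n → ((⟨m⟩ : TL0 k) ⟶ ⟨n⟩)) :=
  (linearIndependent_diagram m n).injective

theorem isDiagram_diagram {m n : ℕ} (p : BallotPair m n) : IsDiagram (diagram k p) :=
  ⟨(linearIndependent_diagram m n).ne_zero p, generated_diagram p⟩

/-- Temperley--Lieb diagrams correspond to pairs of ballot words. -/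
noncomputable def diagramEquiv (k : Type u) [CommRing k] [Nontrivial k] (m n : ℕ) :
    BallotPair m n ≃ {x : (⟨m⟩ : TL0 k) ⟶ ⟨n⟩ // IsDiagram x} :=
  .ofBijective (fun p => ⟨diagram k p, isDiagram_diagram p⟩)
    ⟨fun _ _ h => diagram_injective m n (congrArg Subtype.val h),
      fun x => x.2.exists_eq_diagram.imp fun _ h => Subtype.ext h.symm⟩

/-- The basis of a morphism space given by the Temperley--Lieb diagrams, indexed by pairs of
ballot words. -/
noncomputable def diagramBasis (k : Type u) [CommRing k] [Nontrivial k] (m n : ℕ) :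
    Module.Basis (BallotPair m n) k ((⟨m⟩ : TL0 k) ⟶ ⟨n⟩) :=
  .mk (linearIndependent_diagram m n) (span_range_diagram m n).ge

/-- Any competing factors also come from ballot words, so injectivity of `diagram` identifies the
middle object and both factors at once. -/
theorem IsDiagram.existsUnique_comp {m n : ℕ} {x : (⟨m⟩ : TL0 k) ⟶ ⟨n⟩} (hx : IsDiagram x) :
    ∃! p : (l : TL0 k) × ((⟨m⟩ : TL0 k) ⟶ l) × (l ⟶ (⟨n⟩ : TL0 k)),
      IsCapDiagram p.2.1 ∧ IsCupDiagram p.2.2 ∧ p.2.1 ≫ p.2.2 = x := by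
  obtain ⟨⟨l, b, a⟩, rfl⟩ := hx.exists_eq_diagram
  refine ⟨⟨⟨l⟩, flip (cupDiagram k b), cupDiagram k a⟩,
    ⟨⟨?_, (generated_cupDiagram b).flip⟩, ⟨?_, generated_cupDiagram a⟩, rfl⟩, ?_⟩
  · intro h
    exact hx.1 (by dsimp only at h; rw [diagram, h, Limits.zero_comp])
  · intro h
    exact hx.1 (by dsimp only at h; rw [diagram, h, Limits.comp_zero])
  · rintro ⟨⟨l'⟩, v, w⟩ ⟨hv, hw, h⟩
    dsimp only at hv hw h
    obtain ⟨b', rfl⟩ := hv.2.exists_eq_flip_cupDiagram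
    obtain ⟨a', rfl⟩ := hw.2.exists_eq_cupDiagram
    have := diagram_injective m n (a₁ := ⟨l', b', a'⟩) (a₂ := ⟨l, b, a⟩) h
    cases this
    rfl

end

end TL0

theorem mainTheorem4 (k : Type u) [Field k] (m n : ℕ) :
    (∃ b : Module.Basis {x : (⟨m⟩ : TL0 k) ⟶ ⟨n⟩ // TL0.IsDiagram x} k
        ((⟨m⟩ : TL0 k) ⟶ ⟨n⟩), ∀ x, b x = x.1) ∧
    Module.Finite k ((⟨m⟩ : TL0 k) ⟶ ⟨n⟩) ∧
    (Even (m + n) →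
      Module.finrank k ((⟨m⟩ : TL0 k) ⟶ ⟨n⟩) = catalan ((m + n) / 2)) ∧
    (Odd (m + n) → Module.finrank k ((⟨m⟩ : TL0 k) ⟶ ⟨n⟩) = 0) ∧
    (∀ x : (⟨m⟩ : TL0 k) ⟶ ⟨n⟩, TL0.IsDiagram x →
      ∃! p : (l : TL0 k) × ((⟨m⟩ : TL0 k) ⟶ l) × (l ⟶ (⟨n⟩ : TL0 k)),
        TL0.IsCapDiagram p.2.1 ∧ TL0.IsCupDiagram p.2.2 ∧ p.2.1 ≫ p.2.2 = x) := by
  have hrank := Module.finrank_eq_nat_card_basis (TL0.diagramBasis k m n)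
  refine ⟨⟨(TL0.diagramBasis k m n).reindex (TL0.diagramEquiv k m n), fun x => ?_⟩,
    .of_basis (TL0.diagramBasis k m n), fun h => hrank.trans (BallotPair.card_of_even h),
    fun h => hrank.trans (BallotPair.card_of_odd h), fun x hx => hx.existsUnique_comp⟩
  obtain ⟨p, rfl⟩ := (TL0.diagramEquiv k m n).surjective x
  rw [Module.Basis.reindex_apply, Equiv.symm_apply_apply, TL0.diagramBasis, Module.Basis.mk_apply]
  rfl
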